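/- All vector spaces are complex and finite-dimensional. A quadratic $\mathbb{Z}_2$-graded vector space is a space $V=V_{\bar 0}\oplus V_{\bar 1}$ with a non-degenerate bilinear form $B$ that is even ($B(V_{\bar 0},V_{\bar 1})=0$) and supersymmetric ($B(X,Y)=(-1)^{xy}B(Y,X)$ for $X\in V_x$, $Y\in V_y$). A quadratic Lie superalgebra $(\mathfrak g,B)$ is such a space with a Lie superalgebra bracket satisfying $B([X,Y],Z)=B(X,[Y,Z])$. Write $I(X,Y,Z)=B([X,Y],Z)$, $\mathcal Z(\mathfrak g)$ for the center, and $\phi:\mathfrak g\to\mathfrak g^*$, $\phi(X)(Y)=B(X,Y)$. An endomorphism $C$ that is homogeneous of degree $c$ is skew-supersymmetric if $B(C(X),Y)=-(-1)^{cx}B(X,C(Y))$ for all $X\in\mathfrak g_x$, $Y\in\mathfrak g$. $\mathfrak g$ is reduced if $\mathfrak g\neq 0$ and $\mathcal Z(\mathfrak g)$ is totally isotropic. An element of $\mathfrak g_{\bar 0}^*\otimes\mathfrak g_{\bar 1}^*$ is regarded as a super-antisymmetric bilinear form, $\alpha\otimes q$ being $(X,Y)\mapsto\alpha(X)q(Y)-q(X)\alpha(Y)$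 (forms extended by zero to $\mathfrak g$). For $J\in\mathfrak g_{\bar 0}^*\otimes\mathfrak g_{\bar 1}^*$ and $p\in\mathfrak g_{\bar 1}^*$, the super-exterior product $J\wedge p$ is the super-antisymmetric trilinear form which vanishes on $\mathfrak g_{\bar 0}^3$, $\mathfrak g_{\bar 0}^2\times\mathfrak g_{\bar 1}$ and $\mathfrak g_{\bar 1}^3$ and satisfies $(J\wedge p)(X,Y,Z)=-J(X,Y)p(Z)-J(X,Z)p(Y)$ for $X\in\mathfrak g_{\bar 0}$, $Y,Z\in\mathfrak g_{\bar 1}$. Generalized double extension: let $(\mathfrak q,B_{\mathfrak q})$ be a quadratic $\mathbb{Z}_2$-graded vector space, $\overline C$ an odd skew-supersymmetric endomorphism of $\mathfrak q$ with $\overline C^2=0$, and $X_{\bar 0}'\in\mathfrak q_{\bar 0}$ with $B_{\mathfrak q}(X_{\bar 0}',X_{\bar 0}')=0$ and $\overline C(X_{\bar 0}')=0$. The generalized double extension of $\mathfrak q$ defined by $(\overline C,X_{\bar 0}')$ is the quadratic Lie superalgebra $\mathfrak q\overset{\perp}{\oplus}(\mathbb C X_{\bar 1}\oplus\mathbb C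 Y_{\bar 1})$ with $X_{\bar 1},Y_{\bar 1}$ odd, $B(X_{\bar 1},Y_{\bar 1})=1$, and, for $X,Y\in\mathfrak q$, $$[X_{\bar 1},\cdot]=0,\quad [Y_{\bar 1},Y_{\bar 1}]=X_{\bar 0}',\quad [Y_{\bar 1},X]=\overline C(X)-B(X,X_{\bar 0}')X_{\bar 1},\quad [X,Y]=-B(\overline C(X),Y)X_{\bar 1}.$$ **Statement.** Let $(\mathfrak g,B)$ be a quasi-singular quadratic Lie superalgebra, i.e. $I=J\wedge p$ with $p\in\mathfrak g_{\bar 1}^*$ nonzero and $J\in\mathfrak g_{\bar 0}^*\otimes\mathfrak g_{\bar 1}^*$ indecomposable (not of the form $\alpha\otimes q$). Let $C$ be the endomorphism of $\mathfrak g$ with $B(C(X),Y)=J(X,Y)$ for all $X,Y$, and let $X_{\bar 1}=\phi^{-1}(p)$. Then: 1. $C$ is odd and skew-supersymmetric, $C^2=0$ and $\operatorname{Im}(C)\subset\mathcal Z(\mathfrak g)$. 2. $[\mathfrak g,\mathfrak g]\subset\operatorname{Im}(C)+\mathbb C X_{\bar 1}\subset\mathcal Z(\mathfrak g)$, and $\mathfrak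 g$ is 2-step nilpotent ($[\mathfrak g,\mathfrak g]\ne0$ and $[\mathfrak g,[\mathfrak g,\mathfrak g]]=0$). If $\mathfrak g$ is reduced, then $[\mathfrak g,\mathfrak g]=\operatorname{Im}(C)+\mathbb C X_{\bar 1}=\mathcal Z(\mathfrak g)$. 3. $X_{\bar 1}$ is odd and there is $Y_{\bar 1}\in\mathfrak g_{\bar 1}$ with $B(X_{\bar 1},Y_{\bar 1})=1$. For every such $Y_{\bar 1}$, with $X_{\bar 0}=C(Y_{\bar 1})$ and $\mathfrak q=(\mathbb C X_{\bar 1}\oplus\mathbb C Y_{\bar 1})^{\perp}$, one has, for all $X,Y\in\mathfrak q\oplus\mathbb C X_{\bar 1}$, $$[Y_{\bar 1},Y_{\bar 1}]=2X_{\bar 0},\quad [Y_{\bar 1},X]=C(X)-B(X,X_{\bar 0})X_{\bar 1},\quad [X,Y]=-B(C(X),Y)X_{\bar 1}.$$ 4. For every such $Y_{\bar 1}$, $\mathfrak q$ with the induced grading and form is a quadratic $\mathbb{Z}_2$-graded vector space, and there is an odd skew-supersymmetric $\overline C:\mathfrak q\to\mathfrak q$ with $\overline C^2=0$ and $C(X)=\overline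 C(X)-B(X,X_{\bar 0})X_{\bar 1}$ for $X\in\mathfrak q$. The vector $X_{\bar 0}'=2X_{\bar 0}\in\mathfrak q_{\bar 0}$ is isotropic with $\overline C(X_{\bar 0}')=0$, and for all $X,Y\in\mathfrak q$ $$[Y_{\bar 1},Y_{\bar 1}]=X_{\bar 0}',\quad [Y_{\bar 1},X]=\overline C(X)-B(X,X_{\bar 0}')X_{\bar 1},\quad [X,Y]=-B(\overline C(X),Y)X_{\bar 1}.$$ The decomposition $\mathfrak g=\mathfrak q\oplus\mathbb C X_{\bar 1}\oplus\mathbb C Y_{\bar 1}$ identifies $\mathfrak g$, isometrically and as a Lie superalgebra, with the generalized double extension of $\mathfrak q$ defined by $(\overline C,X_{\bar 0}')$. In particular, $\mathfrak g$ is a generalized double extension of a quadratic $\mathbb{Z}_2$-graded vector space. -/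

import Mathlib

open scoped TensorProduct

noncomputable section

namespace QuasiSingular

/-- The sign `(-1)^{ij}` attached to two parities `i, j ∈ ℤ/2ℤ`. -/
def superSign (i j : ZMod 2) : ℂ := (-1) ^ (i.val * j.val)

/-- A quadratic `ℤ/2ℤ`-graded vector space: `V = V₀ ⊕ V₁` with a non-degenerate even
supersymmetric bilinear form. -/
structure QuadraticSuperspace (V : Type*) [AddCommGroup V] [Module ℂ V] where
  /-- the homogeneous components `V₀` and `V₁` -/
  part : ZMod 2 → Submodule ℂ V
  isCompl : IsCompl (part 0) (part 1)
  form : LinearMap.BilinForm ℂ V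
  form_even : ∀ i j, i ≠ j → ∀ x ∈ part i, ∀ y ∈ part j, form x y = 0
  form_supersymm : ∀ i j, ∀ x ∈ part i, ∀ y ∈ part j, form x y = superSign i j * form y x
  nondegenerate : form.Nondegenerate

namespace QuadraticSuperspace

variable {V : Type*} [AddCommGroup V] [Module ℂ V] (Q : QuadraticSuperspace V)

/-- The projection of `V` on its homogeneous component of parity `i`, as an endomorphism. -/
def component (i : ZMod 2) : V →ₗ[ℂ] V :=
  if i = 0 then (Q.part 0).projection (Q.part 1) Q.isCompl
  else (Q.part 1).projection (Q.part 0) Q.isCompl.symm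

/-- An endomorphism which is homogeneous of degree `c`. -/
def IsHomogeneous (c : ZMod 2) (C : V →ₗ[ℂ] V) : Prop :=
  ∀ i, ∀ x ∈ Q.part i, C x ∈ Q.part (i + c)

/-- Skew-supersymmetry of an endomorphism of degree `c`:
`B(C x, y) = -(-1)^{c i} B(x, C y)` for `x` of parity `i` and all `y`. -/
def IsSkewSupersymmetric (c : ZMod 2) (C : V →ₗ[ℂ] V) : Prop :=
  ∀ i, ∀ x ∈ Q.part i, ∀ y, Q.form (C x) y = -superSign c i * Q.form x (C y)

/-- An even linear form `α ∈ V₀*`, extended by zero on `V₁`. -/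
def extendEven : Module.Dual ℂ (Q.part 0) →ₗ[ℂ] Module.Dual ℂ V :=
  LinearMap.lcomp ℂ ℂ ((Q.part 0).projectionOnto (Q.part 1) Q.isCompl)

/-- An odd linear form `p ∈ V₁*`, extended by zero on `V₀`. -/
def extendOdd : Module.Dual ℂ (Q.part 1) →ₗ[ℂ] Module.Dual ℂ V :=
  LinearMap.lcomp ℂ ℂ ((Q.part 1).projectionOnto (Q.part 0) Q.isCompl.symm)

/-- An element of `Alt¹(V₀) ⊗ Sym¹(V₁) = V₀* ⊗ V₁*` regarded as a super-antisymmetric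
bilinear form on `V`: the tensor `α ⊗ q` is the form
`(X, Y) ↦ α(X) q(Y) - q(X) α(Y)`. -/
def tensorForm :
    Module.Dual ℂ (Q.part 0) ⊗[ℂ] Module.Dual ℂ (Q.part 1) →ₗ[ℂ] LinearMap.BilinForm ℂ V :=
  TensorProduct.lift (LinearMap.mk₂ ℂ
    (fun α q =>
      (LinearMap.mul ℂ ℂ).compl₁₂ (Q.extendEven α) (Q.extendOdd q) -
        (LinearMap.mul ℂ ℂ).compl₁₂ (Q.extendOdd q) (Q.extendEven α))
    (by intros; ext; simp; ring) (by intros; ext; simp; ring)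
    (by intros; ext; simp; ring) (by intros; ext; simp; ring))

/-- The super-exterior product `J ∧ p` of a bilinear form `J` and a linear form `p` of parity `b`,
as a trilinear form. On homogeneous `X, Y, Z` it is the sum over the three `(2,1)`-shuffles of
`(X, Y, Z)`, each with the sign of the shuffle, the Koszul sign for interchanging the arguments,
and the Koszul sign for moving `p` past the two arguments of `J`; it is extended to all of `V` by
linearity. -/
def superWedge (J : LinearMap.BilinForm ℂ V) (b : ZMod 2) (p : Module.Dual ℂ V) (X Y Z : V) : ℂ :=
  ∑ i : ZMod 2, ∑ j : ZMod 2, ∑ k : ZMod 2,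
    (superSign b (i + j) * J (Q.component i X) (Q.component j Y) * p (Q.component k Z)
      - superSign j k * superSign b (i + k) *
          J (Q.component i X) (Q.component k Z) * p (Q.component j Y)
      + superSign i (j + k) * superSign b (j + k) *
          J (Q.component j Y) (Q.component k Z) * p (Q.component i X))

/-- The isomorphism `φ : V → V*`, `φ(X)(Y) = B(X, Y)`. -/
def phi [FiniteDimensional ℂ V] : V ≃ₗ[ℂ] Module.Dual ℂ V :=
  Q.form.toDual Q.nondegenerate

end QuadraticSuperspace

/-- A quadratic Lie superalgebra: a Lie superalgebra structure on a quadratic `ℤ/2ℤ`-graded vector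
space whose bilinear form is invariant. -/
structure QuadraticLieSuperalgebra (V : Type*) [AddCommGroup V] [Module ℂ V]
    extends QuadraticSuperspace V where
  bracket : V →ₗ[ℂ] V →ₗ[ℂ] V
  bracket_mem : ∀ i j, ∀ x ∈ part i, ∀ y ∈ part j, bracket x y ∈ part (i + j)
  bracket_skew : ∀ i j, ∀ x ∈ part i, ∀ y ∈ part j,
    bracket x y = -(superSign i j • bracket y x)
  jacobi : ∀ i j k, ∀ x ∈ part i, ∀ y ∈ part j, ∀ z ∈ part k,
    bracket x (bracket y z) =
      bracket (bracket x y) z + superSign i j • bracket y (bracket x z)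
  invariant : ∀ x y z, form (bracket x y) z = form x (bracket y z)

namespace QuadraticLieSuperalgebra

variable {V : Type*} [AddCommGroup V] [Module ℂ V] (L : QuadraticLieSuperalgebra V)

/-- The associated invariant `I(X, Y, Z) = B([X, Y], Z)`. -/
def associatedInvariant (X Y Z : V) : ℂ := L.form (L.bracket X Y) Z

/-- The center. -/
def center : Submodule ℂ V := LinearMap.ker L.bracket

/-- The derived ideal `[𝔤, 𝔤]`. -/
def derived : Submodule ℂ V := Submodule.span ℂ {z | ∃ x y, z = L.bracket x y}

/-- `𝔤` is nilpotent of class exactly two: `[𝔤, 𝔤] ≠ 0` and `[𝔤, [𝔤, 𝔤]] = 0`. -/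
def IsTwoStepNilpotent : Prop :=
  L.derived ≠ ⊥ ∧ ∀ x, ∀ y ∈ L.derived, L.bracket x y = 0

/-- `𝔤` is reduced: it is nonzero and its center is totally isotropic. -/
def IsReduced : Prop :=
  Nontrivial V ∧ ∀ x ∈ L.center, ∀ y ∈ L.center, L.form x y = 0

/-- The associated invariant is `I = J ∧ p` with `p ∈ 𝔤₁*` nonzero and
`J ∈ Alt¹(𝔤₀) ⊗ Sym¹(𝔤₁)` indecomposable, i.e. not of the form `α ⊗ q`. -/
structure IsQuasiSingularWith
    (J : Module.Dual ℂ (L.part 0) ⊗[ℂ] Module.Dual ℂ (L.part 1))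
    (p : Module.Dual ℂ (L.part 1)) : Prop where
  ne_zero : p ≠ 0
  indecomposable : ∀ (α : Module.Dual ℂ (L.part 0)) (q : Module.Dual ℂ (L.part 1)), J ≠ α ⊗ₜ[ℂ] q
  invariant_eq : ∀ X Y Z, L.associatedInvariant X Y Z =
    L.superWedge (L.tensorForm J) 1 (L.extendOdd p) X Y Z

/-- `e` is an isometric isomorphism of quadratic Lie superalgebras. -/
structure IsIsometricIso {W : Type*} [AddCommGroup W] [Module ℂ W]
    (M : QuadraticLieSuperalgebra W) (e : V ≃ₗ[ℂ] W) : Prop where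
  map_part : ∀ i, ∀ x ∈ L.part i, e x ∈ M.part i
  map_bracket : ∀ x y, e (L.bracket x y) = M.bracket (e x) (e y)
  map_form : ∀ x y, M.form (e x) (e y) = L.form x y

/-- The endomorphism `C` of `𝔤` with `B(C X, Y) = J(X, Y)` for all `X, Y`. -/
def mapOf [FiniteDimensional ℂ V]
    (J : Module.Dual ℂ (L.part 0) ⊗[ℂ] Module.Dual ℂ (L.part 1)) : V →ₗ[ℂ] V :=
  L.phi.symm.toLinearMap ∘ₗ L.tensorForm J

/-- The vector `X₁ = φ⁻¹(p)`. -/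
def vectorOf [FiniteDimensional ℂ V] (p : Module.Dual ℂ (L.part 1)) : V :=
  L.phi.symm (L.extendOdd p)

end QuadraticLieSuperalgebra

/-- The data for a generalized double extension of a quadratic `ℤ/2ℤ`-graded vector space `𝔮`
(regarded as an Abelian Lie superalgebra) by a one-dimensional odd Lie superalgebra: an odd
skew-supersymmetric endomorphism of `𝔮` with square zero, and an isotropic even vector in its
kernel. -/
structure ExtensionDatum (V : Type*) [AddCommGroup V] [Module ℂ V]
    extends QuadraticSuperspace V where
  map : V →ₗ[ℂ] V
  map_odd : toQuadraticSuperspace.IsHomogeneous 1 map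
  map_skew : toQuadraticSuperspace.IsSkewSupersymmetric 1 map
  map_sq : ∀ x, map (map x) = 0
  vec : V
  vec_even : vec ∈ part 0
  vec_isotropic : form vec vec = 0
  map_vec : map vec = 0

namespace ExtensionDatum

variable {V : Type*} [AddCommGroup V] [Module ℂ V] (D : ExtensionDatum V)

/-- The parity involution: `x` on even vectors and `-x` on odd ones. -/
def theta : V →ₗ[ℂ] V := D.component 0 - D.component 1

/-- The homogeneous components of `𝔮 ⊕ ℂ X₁ ⊕ ℂ Y₁`, where `X₁` and `Y₁` are odd. -/
def extPart (i : ZMod 2) : Submodule ℂ (V × ℂ × ℂ) :=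
  (D.part i).prod (if i = 0 then ⊥ else ⊤)

/-- The bilinear form `B_𝔮 + B_𝔱` on `𝔮 ⊕ ℂ X₁ ⊕ ℂ Y₁`, with `B(X₁, Y₁) = 1 = -B(Y₁, X₁)`. The
triple `(x, a, b)` stands for `x + a X₁ + b Y₁`. -/
def extForm : LinearMap.BilinForm ℂ (V × ℂ × ℂ) :=
  LinearMap.mk₂ ℂ (fun u v => D.form u.1 v.1 + (u.2.1 * v.2.2 - u.2.2 * v.2.1))
    (by intros; simp; ring) (by intros; simp; ring)
    (by intros; simp; ring) (by intros; simp; ring)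

/-- The bracket on `𝔮 ⊕ ℂ X₁ ⊕ ℂ Y₁`: the bilinear super-antisymmetric map with
`[Y₁, Y₁] = X₀`, `[Y₁, x] = C x - B(x, X₀) X₁`, `[x, y] = -B(C x, y) X₁` and `[X₁, ·] = 0`
for `x, y ∈ 𝔮`. -/
def extBracket : (V × ℂ × ℂ) →ₗ[ℂ] (V × ℂ × ℂ) →ₗ[ℂ] (V × ℂ × ℂ) :=
  LinearMap.mk₂ ℂ
    (fun u v =>
      (u.2.2 • D.map v.1 - v.2.2 • D.map (D.theta u.1) + (u.2.2 * v.2.2) • D.vec,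
        -D.form (D.map u.1) v.1 - u.2.2 * D.form v.1 D.vec + v.2.2 * D.form u.1 D.vec, 0))
    (by
      intros; ext
      · simp; module
      · simp; ring
      · simp)
    (by
      intros; ext
      · simp; module
      · simp; ring
      · simp)
    (by
      intros; ext
      · simp; module
      · simp; ring
      · simp)
    (by
      intros; ext
      · simp; module
      · simp; ring
      · simp)

theorem exists_add (x : V) : ∃ y ∈ D.part 0, ∃ z ∈ D.part 1, x = y + z := by
  have h : x ∈ D.part 0 ⊔ D.part 1 := by rw [D.isCompl.sup_eq_top]; trivial
  obtain ⟨y, hy, z, hz, rfl⟩ := Submodule.mem_sup.1 h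
  exact ⟨y, hy, z, hz, rfl⟩

theorem theta_even {x : V} (hx : x ∈ D.part 0) : D.theta x = x := by
  simp [theta, QuadraticSuperspace.component, Submodule.projection_apply_of_mem_left _ hx,
    (Submodule.projection_apply_eq_zero_iff D.isCompl.symm).2 hx]

theorem theta_odd {x : V} (hx : x ∈ D.part 1) : D.theta x = -x := by
  simp [theta, QuadraticSuperspace.component, Submodule.projection_apply_of_mem_left _ hx,
    (Submodule.projection_apply_eq_zero_iff D.isCompl).2 hx]

theorem map_even {x : V} (hx : x ∈ D.part 0) : D.map x ∈ D.part 1 := D.map_odd 0 x hx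

theorem map_of_odd {x : V} (hx : x ∈ D.part 1) : D.map x ∈ D.part 0 := D.map_odd 1 x hx

theorem form_map_left (x y : V) : D.form (D.map x) y = -D.form (D.theta x) (D.map y) := by
  obtain ⟨a, ha, b, hb, rfl⟩ := D.exists_add x
  have h0 := D.map_skew 0 a ha y
  have h1 := D.map_skew 1 b hb y
  simp only [superSign, ZMod.val_zero, ZMod.val_one, mul_zero, mul_one, pow_zero, pow_one] at h0 h1
  simp only [map_add, LinearMap.add_apply, h0, h1, D.theta_even ha, D.theta_odd hb, map_neg,
    LinearMap.neg_apply]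
  ring

theorem form_theta_left (x y : V) : D.form (D.theta x) y = D.form x (D.theta y) := by
  obtain ⟨a, ha, b, hb, rfl⟩ := D.exists_add x
  obtain ⟨c, hc, d, hd, rfl⟩ := D.exists_add y
  have h0 := D.form_even 0 1 (by decide) a ha d hd
  have h1 := D.form_even 1 0 (by decide) b hb c hc
  simp [D.theta_even ha, D.theta_odd hb, D.theta_even hc, D.theta_odd hd, h0, h1]

theorem theta_map (x : V) : D.theta (D.map x) = -D.map (D.theta x) := by
  obtain ⟨a, ha, b, hb, rfl⟩ := D.exists_add x
  simp only [map_add, D.theta_even ha, D.theta_odd hb, D.theta_odd (D.map_even ha),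
    D.theta_even (D.map_of_odd hb), map_neg]
  abel

theorem theta_theta (x : V) : D.theta (D.theta x) = x := by
  obtain ⟨a, ha, b, hb, rfl⟩ := D.exists_add x
  simp [D.theta_even ha, D.theta_odd hb]

theorem form_vec (x : V) : D.form D.vec x = D.form x D.vec := by
  obtain ⟨a, ha, b, hb, rfl⟩ := D.exists_add x
  have h0 := D.form_supersymm 0 0 _ D.vec_even a ha
  have h1 := D.form_even 0 1 (by decide) _ D.vec_even b hb
  have h2 := D.form_even 1 0 (by decide) b hb _ D.vec_even
  simp only [superSign, ZMod.val_zero, mul_zero, pow_zero, one_mul] at h0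
  simp [h0, h1, h2]

theorem form_theta_vec (x : V) : D.form (D.theta x) D.vec = D.form x D.vec := by
  rw [form_theta_left, D.theta_even D.vec_even]

theorem extBracket_extBracket (u v w : V × ℂ × ℂ) :
    D.extBracket u (D.extBracket v w) = 0 := by
  simp [extBracket, D.map_sq, D.map_vec, form_map_left, D.vec_isotropic]

theorem extBracket_extBracket_left (u v w : V × ℂ × ℂ) :
    D.extBracket (D.extBracket u v) w = 0 := by
  have h : D.form D.vec (D.map w.1) = 0 := by
    have := D.form_map_left D.vec w.1
    rw [D.map_vec, D.theta_even D.vec_even] at this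
    simpa using this
  simp [extBracket, D.map_sq, D.map_vec, form_map_left, D.vec_isotropic,
    D.theta_map, D.theta_even D.vec_even, D.theta_theta, h]

theorem parity_cases (i : ZMod 2) : i = 0 ∨ i = 1 := by revert i; decide

theorem mem_extPart_zero {u : V × ℂ × ℂ} : u ∈ D.extPart 0 ↔ u.1 ∈ D.part 0 ∧ u.2 = 0 := by
  simp [extPart, Submodule.mem_prod]

theorem mem_extPart_one {u : V × ℂ × ℂ} : u ∈ D.extPart 1 ↔ u.1 ∈ D.part 1 := by
  simp [extPart, Submodule.mem_prod]

/-- The generalized double extension of `𝔮` given by the datum `D`, as a quadratic Lie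
superalgebra on `𝔮 ⊕ ℂ X₁ ⊕ ℂ Y₁`. -/
def extension : QuadraticLieSuperalgebra (V × ℂ × ℂ) where
  part := D.extPart
  isCompl := by
    constructor
    · rw [Submodule.disjoint_def]
      rintro ⟨x, y⟩ ⟨h0, h0'⟩ ⟨h1, -⟩
      have : x = 0 := Submodule.disjoint_def.1 D.isCompl.disjoint x h0 h1
      simp_all
    · rw [codisjoint_iff, eq_top_iff]
      rintro ⟨x, y⟩ -
      obtain ⟨a, ha, b, hb, rfl⟩ := D.exists_add x
      refine Submodule.mem_sup.2 ⟨(a, 0), ⟨ha, by simp⟩, (b, y), ⟨hb, by simp⟩, by simp⟩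
  form := D.extForm
  form_even := by
    intro i j hij x hx y hy
    have h := D.form_even i j hij x.1 hx.1 y.1 hy.1
    have h' : x.2 = 0 ∨ y.2 = 0 := by
      rcases parity_cases i with rfl | rfl
      · exact Or.inl (D.mem_extPart_zero.1 hx).2
      · rcases parity_cases j with rfl | rfl
        · exact Or.inr (D.mem_extPart_zero.1 hy).2
        · exact absurd rfl hij
    rcases h' with h' | h' <;> simp [extForm, h, h']
  form_supersymm := by
    intro i j x hx y hy
    have h := D.form_supersymm i j x.1 hx.1 y.1 hy.1
    simp only [extForm, LinearMap.mk₂_apply, h]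
    rcases parity_cases i with rfl | rfl
    · simp [(D.mem_extPart_zero.1 hx).2]
    · rcases parity_cases j with rfl | rfl
      · simp [(D.mem_extPart_zero.1 hy).2]
      · simp only [superSign, ZMod.val_one]
        ring
  nondegenerate := by
    constructor
    · rintro ⟨x, a, b⟩ h
      have h0 : x = 0 := D.nondegenerate.1 x fun y => by simpa [extForm] using h (y, 0, 0)
      have h1 : a = 0 := by simpa [extForm] using h (0, 0, 1)
      have h2 : b = 0 := by simpa [extForm] using h (0, 1, 0)
      simp [h0, h1, h2]
    · rintro ⟨x, a, b⟩ h
      have h0 : x = 0 := D.nondegenerate.2 x fun y => by simpa [extForm] using h (y, 0, 0)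
      have h1 : a = 0 := by simpa [extForm] using h (0, 0, 1)
      have h2 : b = 0 := by simpa [extForm] using h (0, 1, 0)
      simp [h0, h1, h2]
  bracket := D.extBracket
  bracket_mem := by
    rintro i j ⟨x, a, b⟩ hx ⟨y, c, d⟩ hy
    rcases parity_cases i with rfl | rfl <;> rcases parity_cases j with rfl | rfl
    · rw [mem_extPart_zero] at hx hy
      obtain ⟨hx, hx'⟩ := hx
      obtain ⟨hy, hy'⟩ := hy
      simp only [Prod.mk_eq_zero] at hx' hy'
      obtain ⟨rfl, rfl⟩ := hx'
      obtain ⟨rfl, rfl⟩ := hy'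
      have h := D.form_even 1 0 (by decide) _ (D.map_even hx) y hy
      simp [extBracket, h, mem_extPart_zero]
    · rw [mem_extPart_zero] at hx
      rw [mem_extPart_one] at hy
      obtain ⟨hx, hx'⟩ := hx
      simp only [Prod.mk_eq_zero] at hx'
      obtain ⟨rfl, rfl⟩ := hx'
      rw [zero_add, mem_extPart_one]
      simpa [extBracket, D.theta_even hx] using (D.part 1).smul_mem d (D.map_even hx)
    · rw [mem_extPart_zero] at hy
      rw [mem_extPart_one] at hx
      obtain ⟨hy, hy'⟩ := hy
      simp only [Prod.mk_eq_zero] at hy'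
      obtain ⟨rfl, rfl⟩ := hy'
      rw [add_zero, mem_extPart_one]
      simpa [extBracket] using (D.part 1).smul_mem b (D.map_even hy)
    · rw [mem_extPart_one] at hx hy
      have h := D.form_even 0 1 (by decide) _ (D.map_of_odd hx) y hy
      have h1 := D.form_even 1 0 (by decide) x hx _ D.vec_even
      have h2 := D.form_even 1 0 (by decide) y hy _ D.vec_even
      rw [show (1 : ZMod 2) + 1 = 0 from rfl, mem_extPart_zero]
      refine ⟨?_, by simp_all [extBracket]⟩
      simp only [extBracket, LinearMap.mk₂_apply, D.theta_odd hx]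
      refine add_mem (sub_mem ?_ ?_) ?_
      · exact (D.part 0).smul_mem _ (D.map_of_odd hy)
      · exact (D.part 0).smul_mem _ (D.map_of_odd (neg_mem hx))
      · exact (D.part 0).smul_mem _ D.vec_even
  bracket_skew := by
    rintro i j ⟨x, a, b⟩ hx ⟨y, c, d⟩ hy
    have hs := D.form_map_left x y
    rcases parity_cases i with rfl | rfl <;> rcases parity_cases j with rfl | rfl
    · rw [mem_extPart_zero] at hx hy
      obtain ⟨hx, hx'⟩ := hx
      obtain ⟨hy, hy'⟩ := hy
      simp only [Prod.mk_eq_zero] at hx' hy'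
      obtain ⟨rfl, rfl⟩ := hx'
      obtain ⟨rfl, rfl⟩ := hy'
      have h := D.form_even 1 0 (by decide) _ (D.map_even hx) y hy
      have h' := D.form_even 1 0 (by decide) _ (D.map_even hy) x hx
      simp [extBracket, h, h']
    · rw [mem_extPart_zero] at hx
      rw [mem_extPart_one] at hy
      obtain ⟨hx, hx'⟩ := hx
      simp only [Prod.mk_eq_zero] at hx'
      obtain ⟨rfl, rfl⟩ := hx'
      have h := D.form_supersymm 0 0 x hx _ (D.map_of_odd hy)
      simp only [superSign, ZMod.val_zero, mul_zero, pow_zero, one_mul] at h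
      rw [D.theta_even hx, h] at hs
      have h2 := D.form_even 1 0 (by decide) y hy _ D.vec_even
      simp [extBracket, D.theta_even hx, hs, superSign, h2]
      ring
    · rw [mem_extPart_zero] at hy
      rw [mem_extPart_one] at hx
      obtain ⟨hy, hy'⟩ := hy
      simp only [Prod.mk_eq_zero] at hy'
      obtain ⟨rfl, rfl⟩ := hy'
      have h := D.form_supersymm 1 1 x hx _ (D.map_even hy)
      simp only [superSign, ZMod.val_one, mul_one, pow_one] at h
      rw [D.theta_odd hx, map_neg, LinearMap.neg_apply, neg_neg, h] at hs
      simp [extBracket, D.theta_even hy, hs, superSign]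
      ring
    · rw [mem_extPart_one] at hx hy
      have h := D.form_even 0 1 (by decide) _ (D.map_of_odd hx) y hy
      have h' := D.form_even 0 1 (by decide) _ (D.map_of_odd hy) x hx
      have h1 := D.form_even 1 0 (by decide) x hx _ D.vec_even
      have h2 := D.form_even 1 0 (by decide) y hy _ D.vec_even
      simp [extBracket, D.theta_odd hx, D.theta_odd hy, superSign, ZMod.val_one, h, h', h1, h2]
      module
  jacobi := by
    intros
    simp [extBracket_extBracket, extBracket_extBracket_left]
  invariant := by
    rintro ⟨x, a, b⟩ ⟨y, c, d⟩ ⟨z, e, f⟩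
    have h1 : D.form (D.map x) y = D.form x (D.map (D.theta y)) := by
      rw [form_map_left, form_theta_left, theta_map, map_neg, neg_neg]
    have h2 : D.form (D.map (D.theta x)) z = -D.form x (D.map z) := by
      rw [form_map_left, theta_theta]
    simp only [extForm, extBracket, LinearMap.mk₂_apply, map_add, map_sub, map_smul,
      LinearMap.add_apply, LinearMap.sub_apply, LinearMap.smul_apply, smul_eq_mul, h1, h2,
      form_vec]
    ring

end ExtensionDatum

/-- `𝔤` is isometrically isomorphic to a generalized double extension of a quadratic
`ℤ/2ℤ`-graded vector space. -/
def QuadraticLieSuperalgebra.IsGeneralizedDoubleExtension.{u} {V : Type u} [AddCommGroup V]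
    [Module ℂ V] (L : QuadraticLieSuperalgebra V) : Prop :=
  ∃ (W : Type u) (_ : AddCommGroup W) (_ : Module ℂ W) (_ : FiniteDimensional ℂ W)
    (D : ExtensionDatum W) (e : V ≃ₗ[ℂ] W × ℂ × ℂ), L.IsIsometricIso D.extension e

end QuasiSingular

end

/-!
Write `B` for the form and `θ` for the parity involution. Moving `I = J ∧ p` through `B` turns it
into the bracket `[X, Y] = B(X₁, X) C Y - B(X₁, Y) C θX - B(C X, Y) X₁`, with `C` odd and
`(X, Y) ↦ B(C X, Y)` antisymmetric.

Fix an odd `Y` with `B(X₁, Y) = 1`. The even part is abelian, so its elements act on the odd part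
by commuting operators; evaluating the commutators on `Y` shows that if `C X₁ ≠ 0`, then `C`
vanishes on the even vectors orthogonal to `C X₁`. Thus `C` would have rank at most one on the even
part and `J` would be decomposable, so `C X₁ = 0`. Then `C² = 0` on even vectors `X` because
`0 = [X, [Y, Y]] = 2 [[X, Y], Y]`, and on odd vectors because `[[Y, Y], Y] = 0`; the latter covers
all odd vectors since the `Y` with `B(X₁, Y) = 1` span the odd part.

Once `C X₁ = 0` and `C² = 0`, the remaining assertions are read off from the bracket formula and the
splitting of `𝔤` along the hyperbolic pair `X₁, Y`.
-/

namespace QuasiSingular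

theorem superSign_zero_left (i : ZMod 2) : superSign 0 i = 1 := by simp [superSign]

theorem superSign_zero_right (i : ZMod 2) : superSign i 0 = 1 := by simp [superSign]

theorem superSign_one_one : superSign 1 1 = -1 := by simp [superSign, ZMod.val_one]

namespace QuadraticSuperspace

variable {V : Type*} [AddCommGroup V] [Module ℂ V] (Q : QuadraticSuperspace V)

section Grading

theorem exists_even_add_odd (x : V) : ∃ a ∈ Q.part 0, ∃ b ∈ Q.part 1, a + b = x := by
  obtain ⟨a, b, ha, hb, hab⟩ := Submodule.codisjoint_iff_exists_add_eq.mp Q.isCompl.codisjoint x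
  exact ⟨a, ha, b, hb, hab⟩

theorem component_of_mem {i : ZMod 2} {x : V} (hx : x ∈ Q.part i) : Q.component i x = x := by
  rcases ExtensionDatum.parity_cases i with rfl | rfl <;>
    simp [component, Submodule.projection_apply_of_mem_left _ hx]

theorem component_of_mem_of_ne {i j : ZMod 2} {x : V} (hx : x ∈ Q.part i) (hij : i ≠ j) :
    Q.component j x = 0 := by
  rcases ExtensionDatum.parity_cases i with rfl | rfl <;>
    rcases ExtensionDatum.parity_cases j with rfl | rfl
  · exact absurd rfl hij
  · simp [component, (Submodule.projection_apply_eq_zero_iff Q.isCompl.symm).2 hx]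
  · simp [component, (Submodule.projection_apply_eq_zero_iff Q.isCompl).2 hx]
  · exact absurd rfl hij

theorem component_mem (i : ZMod 2) (x : V) : Q.component i x ∈ Q.part i := by
  rcases ExtensionDatum.parity_cases i with rfl | rfl <;>
    simp [component, Submodule.projection_apply_mem]

theorem component_add_component_add_one (i : ZMod 2) (x : V) :
    Q.component i x + Q.component (i + 1) x = x := by
  rcases ExtensionDatum.parity_cases i with rfl | rfl
  · exact Submodule.projection_add_projection_eq_self Q.isCompl x
  · exact Submodule.projection_add_projection_eq_self Q.isCompl.symm x

/-- The parity involution `θ`: `x` on even vectors and `-x` on odd ones. It carries the signs in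
formulas for vectors that are not homogeneous. -/
noncomputable def parity : V →ₗ[ℂ] V := Q.component 0 - Q.component 1

theorem parity_even {x : V} (hx : x ∈ Q.part 0) : Q.parity x = x := by
  simp [parity, Q.component_of_mem hx, Q.component_of_mem_of_ne hx zero_ne_one]

theorem parity_odd {x : V} (hx : x ∈ Q.part 1) : Q.parity x = -x := by
  simp [parity, Q.component_of_mem hx, Q.component_of_mem_of_ne hx one_ne_zero]

end Grading

section Form

theorem form_even_odd {x y : V} (hx : x ∈ Q.part 0) (hy : y ∈ Q.part 1) : Q.form x y = 0 :=
  Q.form_even 0 1 zero_ne_one x hx y hy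

theorem form_odd_even {x y : V} (hx : x ∈ Q.part 1) (hy : y ∈ Q.part 0) : Q.form x y = 0 :=
  Q.form_even 1 0 one_ne_zero x hx y hy

theorem form_comm_of_even {x : V} (hx : x ∈ Q.part 0) (y : V) : Q.form x y = Q.form y x := by
  obtain ⟨a, ha, b, hb, rfl⟩ := Q.exists_even_add_odd y
  have hxa := Q.form_supersymm 0 0 x hx a ha
  rw [superSign_zero_left, one_mul] at hxa
  simp [hxa, Q.form_even_odd hx hb, Q.form_odd_even hb hx]

theorem form_comm_of_odd {x : V} (hx : x ∈ Q.part 1) (y : V) : Q.form x y = -Q.form y x := by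
  obtain ⟨a, ha, b, hb, rfl⟩ := Q.exists_even_add_odd y
  have hxb := Q.form_supersymm 1 1 x hx b hb
  rw [superSign_one_one, neg_one_mul] at hxb
  simp [hxb, Q.form_even_odd ha hx, Q.form_odd_even hx ha]

theorem form_self_of_odd {x : V} (hx : x ∈ Q.part 1) : Q.form x x = 0 :=
  self_eq_neg.1 (Q.form_comm_of_odd hx x)

theorem ext_form {x y : V} (h : ∀ z, Q.form x z = Q.form y z) : x = y :=
  sub_eq_zero.1 (Q.nondegenerate.1 _ fun z => by simp [h z])

theorem form_component_left (i : ZMod 2) (x y : V) :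
    Q.form (Q.component i x) y = Q.form x (Q.component i y) := by
  have hne : i ≠ i + 1 := by simp
  have hxy := Q.form_even i (i + 1) hne _ (Q.component_mem i x) _ (Q.component_mem (i + 1) y)
  have hyx := Q.form_even (i + 1) i hne.symm _ (Q.component_mem (i + 1) x) _ (Q.component_mem i y)
  calc Q.form (Q.component i x) y
      = Q.form (Q.component i x) (Q.component i y + Q.component (i + 1) y) := by
        rw [component_add_component_add_one]
    _ = Q.form (Q.component i x + Q.component (i + 1) x) (Q.component i y) := by
        simp only [map_add, LinearMap.add_apply, hxy, hyx]
    _ = Q.form x (Q.component i y) := by rw [component_add_component_add_one]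

theorem mem_part_of_form_eq_zero {i : ZMod 2} {x : V}
    (h : ∀ y ∈ Q.part (i + 1), Q.form x y = 0) : x ∈ Q.part i := by
  have hx : Q.component (i + 1) x = 0 := Q.ext_form fun y => by
    simp [form_component_left, h _ (Q.component_mem _ y)]
  rw [← Q.component_add_component_add_one i x, hx, add_zero]
  exact Q.component_mem i x

theorem exists_form_eq_one {i : ZMod 2} {x : V} (hx : x ∈ Q.part i) (hx₀ : x ≠ 0) :
    ∃ y ∈ Q.part i, Q.form x y = 1 := by
  obtain ⟨y, hy⟩ : ∃ y, Q.form x y ≠ 0 := by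
    by_contra! h
    exact hx₀ (Q.nondegenerate.1 x h)
  refine ⟨(Q.form x y)⁻¹ • Q.component i y,
    Submodule.smul_mem _ _ (Q.component_mem i y), ?_⟩
  rw [map_smul, ← form_component_left, Q.component_of_mem hx, smul_eq_mul, inv_mul_cancel₀ hy]

theorem form_phi_symm [FiniteDimensional ℂ V] (f : Module.Dual ℂ V) (x : V) :
    Q.form (Q.phi.symm f) x = f x :=
  LinearMap.congr_fun (Q.phi.apply_symm_apply f) x

end Form

section OddMaps

variable {Q} {C : V →ₗ[ℂ] V}

theorem IsHomogeneous.map_even (hC : Q.IsHomogeneous 1 C) {x : V} (hx : x ∈ Q.part 0) :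
    C x ∈ Q.part 1 := hC 0 x hx

theorem IsHomogeneous.map_odd (hC : Q.IsHomogeneous 1 C) {x : V} (hx : x ∈ Q.part 1) :
    C x ∈ Q.part 0 := hC 1 x hx

theorem isHomogeneous_one_of_form
    (h₀ : ∀ x ∈ Q.part 0, ∀ y ∈ Q.part 0, Q.form (C x) y = 0)
    (h₁ : ∀ x ∈ Q.part 1, ∀ y ∈ Q.part 1, Q.form (C x) y = 0) : Q.IsHomogeneous 1 C := by
  intro i x hx
  rcases ExtensionDatum.parity_cases i with rfl | rfl
  · exact Q.mem_part_of_form_eq_zero (h₀ x hx)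
  · exact Q.mem_part_of_form_eq_zero (h₁ x hx)

theorem isSkewSupersymmetric_one_iff :
    Q.IsSkewSupersymmetric 1 C ↔ ∀ x y, Q.form (C x) y = -Q.form (C y) x := by
  have hsign {i : ZMod 2} {x : V} (hx : x ∈ Q.part i) (y : V) :
      superSign 1 i * Q.form x (C y) = Q.form (C y) x := by
    rcases ExtensionDatum.parity_cases i with rfl | rfl
    · rw [superSign_zero_right, one_mul, Q.form_comm_of_even hx]
    · rw [superSign_one_one, Q.form_comm_of_odd hx, neg_mul_neg, one_mul]
  constructor
  · intro h x y
    obtain ⟨a, ha, b, hb, rfl⟩ := Q.exists_even_add_odd x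
    simp only [map_add, LinearMap.add_apply, h 0 a ha, h 1 b hb, neg_mul, hsign ha, hsign hb]
    ring
  · intro h i x hx y
    rw [h, neg_mul, hsign hx]

end OddMaps

section SuperExteriorAlgebra

theorem extendEven_apply (α : Module.Dual ℂ (Q.part 0)) (x : Q.part 0) :
    Q.extendEven α x = α x := by
  simp [extendEven]

theorem extendEven_odd (α : Module.Dual ℂ (Q.part 0)) {x : V} (hx : x ∈ Q.part 1) :
    Q.extendEven α x = 0 := by
  simp [extendEven, (Submodule.projectionOnto_apply_eq_zero_iff Q.isCompl).2 hx]

theorem extendOdd_apply (q : Module.Dual ℂ (Q.part 1)) (x : Q.part 1) :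
    Q.extendOdd q x = q x := by
  simp [extendOdd]

theorem extendOdd_even (q : Module.Dual ℂ (Q.part 1)) {x : V} (hx : x ∈ Q.part 0) :
    Q.extendOdd q x = 0 := by
  simp [extendOdd, (Submodule.projectionOnto_apply_eq_zero_iff Q.isCompl.symm).2 hx]

theorem tensorForm_tmul (α : Module.Dual ℂ (Q.part 0)) (q : Module.Dual ℂ (Q.part 1)) (x y : V) :
    Q.tensorForm (α ⊗ₜ q) x y =
      Q.extendEven α x * Q.extendOdd q y - Q.extendOdd q x * Q.extendEven α y := by
  simp [tensorForm]

variable (J : Module.Dual ℂ (Q.part 0) ⊗[ℂ] Module.Dual ℂ (Q.part 1))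

theorem tensorForm_antisymm (x y : V) : Q.tensorForm J x y = -Q.tensorForm J y x := by
  induction J with
  | zero => simp
  | tmul α q => simp only [tensorForm_tmul]; ring
  | add J K hJ hK => simp only [map_add, LinearMap.add_apply, hJ, hK]; ring

theorem tensorForm_even_even {x y : V} (hx : x ∈ Q.part 0) (hy : y ∈ Q.part 0) :
    Q.tensorForm J x y = 0 := by
  induction J with
  | zero => simp
  | tmul α q => simp [tensorForm_tmul, Q.extendOdd_even q hx, Q.extendOdd_even q hy]
  | add J K hJ hK => simp [hJ, hK]

theorem tensorForm_odd_odd {x y : V} (hx : x ∈ Q.part 1) (hy : y ∈ Q.part 1) :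
    Q.tensorForm J x y = 0 := by
  induction J with
  | zero => simp
  | tmul α q => simp [tensorForm_tmul, Q.extendEven_odd α hx, Q.extendEven_odd α hy]
  | add J K hJ hK => simp [hJ, hK]

theorem tensorForm_even_odd (x : Q.part 0) (y : Q.part 1) :
    Q.tensorForm J x y = TensorProduct.dualDistrib ℂ (Q.part 0) (Q.part 1) J (x ⊗ₜ y) := by
  induction J with
  | zero => simp
  | tmul α q =>
    simp [tensorForm_tmul, Q.extendOdd_even q x.2, Q.extendEven_apply, Q.extendOdd_apply]
  | add J K hJ hK => simp [hJ, hK]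

variable {Q J} in
theorem ext_tensorForm [FiniteDimensional ℂ V]
    {K : Module.Dual ℂ (Q.part 0) ⊗[ℂ] Module.Dual ℂ (Q.part 1)}
    (h : ∀ (x : Q.part 0) (y : Q.part 1), Q.tensorForm J x y = Q.tensorForm K x y) : J = K := by
  apply (TensorProduct.dualDistribEquiv ℂ (Q.part 0) (Q.part 1)).injective
  exact TensorProduct.ext' fun x y =>
    (Q.tensorForm_even_odd J x y).symm.trans ((h x y).trans (Q.tensorForm_even_odd K x y))

theorem superWedge_one_apply {F : LinearMap.BilinForm ℂ V} {p : Module.Dual ℂ V}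
    (hF₀ : ∀ x ∈ Q.part 0, ∀ y ∈ Q.part 0, F x y = 0)
    (hF₁ : ∀ x ∈ Q.part 1, ∀ y ∈ Q.part 1, F x y = 0)
    (hp : ∀ x ∈ Q.part 0, p x = 0) (x y z : V) :
    Q.superWedge F 1 p x y z = p x * F y z - p y * F (Q.parity x) z - p z * F x y := by
  obtain ⟨x₀, hx₀, x₁, hx₁, rfl⟩ := Q.exists_even_add_odd x
  obtain ⟨y₀, hy₀, y₁, hy₁, rfl⟩ := Q.exists_even_add_odd y
  obtain ⟨z₀, hz₀, z₁, hz₁, rfl⟩ := Q.exists_even_add_odd z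
  have h₀ {v w : V} (hv : v ∈ Q.part 0) (hw : w ∈ Q.part 1) : Q.component 0 (v + w) = v := by
    rw [map_add, Q.component_of_mem hv, Q.component_of_mem_of_ne hw one_ne_zero, add_zero]
  have h₁ {v w : V} (hv : v ∈ Q.part 0) (hw : w ∈ Q.part 1) : Q.component 1 (v + w) = w := by
    rw [map_add, Q.component_of_mem hw, Q.component_of_mem_of_ne hv zero_ne_one, zero_add]
  have hsum (f : ZMod 2 → ℂ) : ∑ i, f i = f 0 + f 1 := Fin.sum_univ_two f
  have hone : (1 : ZMod 2) + 1 = 0 := rfl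
  simp only [superWedge, hsum, h₀ hx₀ hx₁, h₁ hx₀ hx₁, h₀ hy₀ hy₁, h₁ hy₀ hy₁, h₀ hz₀ hz₁,
    h₁ hz₀ hz₁]
  simp only [map_add, LinearMap.add_apply, Q.parity_even hx₀, Q.parity_odd hx₁, map_neg,
    LinearMap.neg_apply, hp _ hx₀, hp _ hy₀, hp _ hz₀, hF₀ _ hx₀ _ hy₀, hF₀ _ hx₀ _ hz₀,
    hF₀ _ hy₀ _ hz₀, hF₁ _ hx₁ _ hy₁, hF₁ _ hx₁ _ hz₁, hF₁ _ hy₁ _ hz₁, zero_add, add_zero,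
    hone, superSign_zero_left, superSign_zero_right, superSign_one_one]
  ring

end SuperExteriorAlgebra

section HyperbolicPair

/-- An odd hyperbolic pair: odd vectors `X, Y` with `B(X, Y) = 1`. They are automatically isotropic,
because the form is alternating on the odd part. -/
structure IsOddHyperbolicPair (X Y : V) : Prop where
  left_mem : X ∈ Q.part 1
  right_mem : Y ∈ Q.part 1
  form_eq_one : Q.form X Y = 1

/-- The space `𝔮 = (ℂ X ⊕ ℂ Y)^⊥`. -/
abbrev pairOrthogonal (X Y : V) : Submodule ℂ V := Q.form.orthogonal (Submodule.span ℂ {X, Y})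

variable {Q} {X Y : V}

theorem mem_pairOrthogonal {x : V} :
    x ∈ Q.pairOrthogonal X Y ↔ Q.form X x = 0 ∧ Q.form Y x = 0 := by
  rw [LinearMap.BilinForm.mem_orthogonal_iff]
  constructor
  · intro h
    exact ⟨h X (Submodule.subset_span (by simp)), h Y (Submodule.subset_span (by simp))⟩
  · rintro ⟨hX, hY⟩ v hv
    obtain ⟨a, b, rfl⟩ := Submodule.mem_span_pair.1 hv
    simp [hX, hY]

namespace IsOddHyperbolicPair

variable (hXY : Q.IsOddHyperbolicPair X Y)
include hXY

theorem form_swap : Q.form Y X = -1 := by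
  rw [Q.form_comm_of_odd hXY.right_mem, hXY.form_eq_one]

theorem form_add_smul_add_smul (x y : Q.pairOrthogonal X Y) (a b c d : ℂ) :
    Q.form (x + a • X + b • Y) (y + c • X + d • Y) = Q.form x y + (a * d - b * c) := by
  obtain ⟨hXx, hYx⟩ := mem_pairOrthogonal.1 x.2
  obtain ⟨hXy, hYy⟩ := mem_pairOrthogonal.1 y.2
  rw [Q.form_comm_of_odd hXY.left_mem, neg_eq_zero] at hXx
  rw [Q.form_comm_of_odd hXY.right_mem, neg_eq_zero] at hYx
  simp only [map_add, map_smul, LinearMap.add_apply, LinearMap.smul_apply, smul_eq_mul, hXx, hYx,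
    hXy, hYy, Q.form_self_of_odd hXY.left_mem, Q.form_self_of_odd hXY.right_mem, hXY.form_eq_one,
    hXY.form_swap]
  ring

/-- The projection of `V` on `𝔮` along `ℂ X ⊕ ℂ Y`. -/
noncomputable def projection : V →ₗ[ℂ] Q.pairOrthogonal X Y :=
  LinearMap.codRestrict _
    (LinearMap.id + (Q.form Y).smulRight X - (Q.form X).smulRight Y) fun x => by
      rw [mem_pairOrthogonal]
      simp [hXY.form_eq_one, hXY.form_swap, Q.form_self_of_odd hXY.left_mem,
        Q.form_self_of_odd hXY.right_mem]

theorem coe_projection (x : V) :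
    (hXY.projection x : V) = x + Q.form Y x • X - Q.form X x • Y := rfl

/-- The decomposition `V = 𝔮 ⊕ ℂ X ⊕ ℂ Y`, in the coordinates `x + a X + b Y ↦ (x, a, b)`. -/
noncomputable def decomposition : V ≃ₗ[ℂ] Q.pairOrthogonal X Y × ℂ × ℂ :=
  { hXY.projection.prod ((-Q.form Y).prod (Q.form X)) with
    invFun := fun u => u.1 + u.2.1 • X + u.2.2 • Y
    left_inv := fun x => by
      change (hXY.projection x : V) + (-Q.form Y x) • X + Q.form X x • Y = x
      rw [coe_projection]
      module
    right_inv := by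
      rintro ⟨⟨x, hx⟩, a, b⟩
      obtain ⟨hXx, hYx⟩ := mem_pairOrthogonal.1 hx
      have hb : Q.form X (x + a • X + b • Y) = b := by
        simp [hXx, Q.form_self_of_odd hXY.left_mem, hXY.form_eq_one]
      have ha : Q.form Y (x + a • X + b • Y) = -a := by
        simp [hYx, Q.form_self_of_odd hXY.right_mem, hXY.form_swap]
      refine Prod.ext (Subtype.ext ?_) (Prod.ext (neg_eq_iff_eq_neg.2 ha) hb)
      change (hXY.projection (x + a • X + b • Y) : V) = x
      rw [coe_projection, ha, hb]
      module }

theorem decomposition_apply (x : V) :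
    hXY.decomposition x = (hXY.projection x, -Q.form Y x, Q.form X x) := rfl

theorem decomposition_add (x : Q.pairOrthogonal X Y) (a b : ℂ) :
    hXY.decomposition (x + a • X + b • Y) = (x, a, b) :=
  hXY.decomposition.apply_symm_apply (x, a, b)

theorem exists_eq_add_smul_add_smul (v : V) :
    ∃ (x : Q.pairOrthogonal X Y) (a b : ℂ), v = x + a • X + b • Y :=
  ⟨_, _, _, (hXY.decomposition.symm_apply_apply v).symm⟩

theorem form_projection_left (v : V) (x : Q.pairOrthogonal X Y) :
    Q.form (hXY.projection v) x = Q.form v x := by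
  obtain ⟨hX, hY⟩ := mem_pairOrthogonal.1 x.2
  simp [coe_projection, hX, hY]

theorem form_projection_right (x : Q.pairOrthogonal X Y) (v : V) :
    Q.form x (hXY.projection v) = Q.form x v := by
  obtain ⟨hX, hY⟩ := mem_pairOrthogonal.1 x.2
  rw [Q.form_comm_of_odd hXY.left_mem, neg_eq_zero] at hX
  rw [Q.form_comm_of_odd hXY.right_mem, neg_eq_zero] at hY
  simp [coe_projection, hX, hY]

theorem projection_mem {i : ZMod 2} {x : V} (hx : x ∈ Q.part i) :
    (hXY.projection x : V) ∈ Q.part i := by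
  rw [coe_projection]
  rcases ExtensionDatum.parity_cases i with rfl | rfl
  · simpa [Q.form_odd_even hXY.left_mem hx, Q.form_odd_even hXY.right_mem hx] using hx
  · exact sub_mem (add_mem hx (Submodule.smul_mem _ _ hXY.left_mem))
      (Submodule.smul_mem _ _ hXY.right_mem)

theorem projection_coe (x : Q.pairOrthogonal X Y) : hXY.projection x = x := by
  obtain ⟨hX, hY⟩ := mem_pairOrthogonal.1 x.2
  exact Subtype.ext (by simp [coe_projection, hX, hY])

/-- The quadratic graded space `𝔮`, with the grading and the form induced from `V`. -/
def orthogonalSuperspace : QuadraticSuperspace (Q.pairOrthogonal X Y) where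
  part i := (Q.part i).comap (Q.pairOrthogonal X Y).subtype
  isCompl := by
    constructor
    · rw [Submodule.disjoint_def]
      intro x h₀ h₁
      exact Subtype.ext (Submodule.disjoint_def.1 Q.isCompl.disjoint x h₀ h₁)
    · rw [Submodule.codisjoint_iff_exists_add_eq]
      intro x
      obtain ⟨a, ha, b, hb, hab⟩ := Q.exists_even_add_odd (x : V)
      exact ⟨hXY.projection a, hXY.projection b, hXY.projection_mem ha, hXY.projection_mem hb,
        by rw [← map_add, hab, projection_coe]⟩
  form := Q.form.restrict _
  form_even i j hij x hx y hy := Q.form_even i j hij x hx y hy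
  form_supersymm i j x hx y hy := Q.form_supersymm i j x hx y hy
  nondegenerate :=
    ⟨fun x hx => Subtype.ext (Q.nondegenerate.1 x fun v =>
        (hXY.form_projection_right x v).symm.trans (hx (hXY.projection v))),
      fun x hx => Subtype.ext (Q.nondegenerate.2 x fun v =>
        (hXY.form_projection_left v x).symm.trans (hx (hXY.projection v)))⟩

end IsOddHyperbolicPair

end HyperbolicPair

end QuadraticSuperspace

namespace ExtensionDatum

variable {V : Type*} [AddCommGroup V] [Module ℂ V] (D : ExtensionDatum V)

theorem extension_form_apply (x y : V) (a b c d : ℂ) :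
    D.extension.form (x, a, b) (y, c, d) = D.form x y + (a * d - b * c) := rfl

theorem extension_bracket_apply (x y : V) (a b c d : ℂ) :
    D.extension.bracket (x, a, b) (y, c, d) =
      (b • D.map y - d • D.map (D.theta x) + (b * d) • D.vec,
        -D.form (D.map x) y - b * D.form y D.vec + d * D.form x D.vec, 0) := rfl

end ExtensionDatum

namespace QuadraticLieSuperalgebra

variable {V : Type*} [AddCommGroup V] [Module ℂ V] {L : QuadraticLieSuperalgebra V}

section General

theorem bracket_odd_right {y : V} (hy : y ∈ L.part 1) (x : V) :
    L.bracket x y = -L.bracket y (L.parity x) := by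
  obtain ⟨a, ha, b, hb, rfl⟩ := L.exists_even_add_odd x
  have hay := L.bracket_skew 0 1 a ha y hy
  have hby := L.bracket_skew 1 1 b hb y hy
  rw [superSign_zero_left, one_smul] at hay
  rw [superSign_one_one, neg_one_smul, neg_neg] at hby
  simp only [map_add, LinearMap.add_apply, hay, hby, L.parity_even ha, L.parity_odd hb, map_neg]
  abel

theorem bracket_even_bracket_self {x y : V} (hx : x ∈ L.part 0) (hy : y ∈ L.part 1) :
    L.bracket x (L.bracket y y) = (2 : ℂ) • L.bracket (L.bracket x y) y := by
  have hxy : L.bracket x y ∈ L.part 1 := L.bracket_mem 0 1 x hx y hy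
  have hswap : L.bracket y (L.bracket x y) = L.bracket (L.bracket x y) y := by
    rw [bracket_odd_right hy (L.bracket x y), L.parity_odd hxy, map_neg, neg_neg]
  rw [L.jacobi 0 1 1 x hx y hy y hy, hswap, superSign_zero_left, one_smul, two_smul]

theorem bracket_bracket_self_of_odd {y : V} (hy : y ∈ L.part 1) :
    L.bracket (L.bracket y y) y = 0 := by
  have hyy : L.bracket y y ∈ L.part 0 := L.bracket_mem 1 1 y hy y hy
  have hskew := bracket_odd_right hy (L.bracket y y)
  rw [L.parity_even hyy] at hskew
  have hjac := L.jacobi 1 1 1 y hy y hy y hy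
  rw [superSign_one_one, neg_one_smul] at hjac
  have h3 : (3 : ℂ) • L.bracket y (L.bracket y y) = 0 := by
    rw [hskew] at hjac
    linear_combination (norm := module) hjac
  rw [hskew, (smul_eq_zero.1 h3).resolve_left three_ne_zero, neg_zero]

theorem mem_center_of_form_derived {x : V} (hx : ∀ y ∈ L.derived, L.form x y = 0) :
    x ∈ L.center := by
  refine LinearMap.mem_ker.2 (LinearMap.ext fun y => L.ext_form fun z => ?_)
  rw [L.invariant, hx _ (Submodule.subset_span ⟨y, z, rfl⟩)]
  simp

theorem center_le_derived_of_isotropic [FiniteDimensional ℂ V]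
    (hL : ∀ x ∈ L.center, ∀ y ∈ L.center, L.form x y = 0) : L.center ≤ L.derived := by
  intro x hx
  by_contra hxL
  obtain ⟨f, hfx, hf⟩ := Submodule.exists_le_ker_of_notMem hxL
  have hcenter : L.phi.symm f ∈ L.center := mem_center_of_form_derived fun y hy => by
    rw [L.form_phi_symm]
    exact hf hy
  exact hfx (by rw [← L.form_phi_symm, hL _ hcenter x hx])

end General

variable {C : V →ₗ[ℂ] V} {X₁ Y₁ : V}

variable (L C X₁) in
/-- The bracket of `L` has associated invariant `J ∧ p`, where `J(X, Y) = B(C X, Y)` and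
`p = B(X₁, ·)`, with `C` odd skew-supersymmetric and `X₁` odd. The parity involution absorbs the
signs of the super-exterior product. -/
structure IsWedgeBracket : Prop where
  homogeneous : L.IsHomogeneous 1 C
  skew : L.IsSkewSupersymmetric 1 C
  vec_mem : X₁ ∈ L.part 1
  bracket_eq : ∀ x y, L.bracket x y =
    L.form X₁ x • C y - L.form X₁ y • C (L.parity x) - L.form (C x) y • X₁

variable (L C X₁) in
/-- A bracket with associated invariant `J ∧ p` for which `C X₁ = 0` and `C² = 0`. -/
structure IsNilpotentWedgeBracket : Prop extends L.IsWedgeBracket C X₁ where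
  map_vec : C X₁ = 0
  map_map : ∀ x, C (C x) = 0

namespace IsWedgeBracket

variable (h : L.IsWedgeBracket C X₁)
include h

theorem form_map_antisymm (x y : V) : L.form (C x) y = -L.form (C y) x :=
  QuadraticSuperspace.isSkewSupersymmetric_one_iff.1 h.skew x y

theorem form_vec_vec : L.form X₁ X₁ = 0 := L.form_self_of_odd h.vec_mem

theorem form_vec_even {x : V} (hx : x ∈ L.part 0) : L.form X₁ x = 0 :=
  L.form_odd_even h.vec_mem hx

theorem form_vec_map (x : V) : L.form X₁ (C x) = L.form (C X₁) x := by
  rw [L.form_comm_of_odd h.vec_mem, ← h.form_map_antisymm]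

theorem bracket_even_even {x y : V} (hx : x ∈ L.part 0) (hy : y ∈ L.part 0) :
    L.bracket x y = 0 := by
  simp [h.bracket_eq, h.form_vec_even hx, h.form_vec_even hy,
    L.form_odd_even (h.homogeneous.map_even hx) hy]

theorem bracket_even_left {x : V} (hx : x ∈ L.part 0) (y : V) :
    L.bracket x y = -L.form X₁ y • C x - L.form (C x) y • X₁ := by
  rw [h.bracket_eq, h.form_vec_even hx, L.parity_even hx]
  module

theorem bracket_odd_odd {x y : V} (hx : x ∈ L.part 1) (hy : y ∈ L.part 1) :
    L.bracket x y = L.form X₁ x • C y + L.form X₁ y • C x := by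
  rw [h.bracket_eq, L.parity_odd hx, L.form_even_odd (h.homogeneous.map_odd hx) hy, map_neg]
  module

theorem bracket_self (hY : L.IsOddHyperbolicPair X₁ Y₁) : L.bracket Y₁ Y₁ = (2 : ℂ) • C Y₁ := by
  rw [h.bracket_odd_odd hY.right_mem hY.right_mem, hY.form_eq_one]
  module

theorem bracket_even_bracket_even {x x' : V} (hx : x ∈ L.part 0) (hx' : x' ∈ L.part 0)
    (hY : L.IsOddHyperbolicPair X₁ Y₁) :
    L.bracket x (L.bracket x' Y₁) = L.form (C X₁) x' • C x +
      (L.form (C x) (C x') - L.form (C x') Y₁ * L.form (C X₁) x) • X₁ := by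
  rw [h.bracket_even_left hx', hY.form_eq_one, map_sub, map_smul, map_smul,
    h.bracket_even_left hx, h.bracket_even_left hx, h.form_vec_vec, h.form_vec_map,
    h.form_map_antisymm x X₁]
  module

theorem map_eq_zero_of_form_map_vec_eq_zero (hv : C X₁ ≠ 0) {x : V} (hx : x ∈ L.part 0)
    (hvx : L.form (C X₁) x = 0) : C x = 0 := by
  have hX₁ : X₁ ≠ 0 := fun h₀ => hv (by rw [h₀, map_zero])
  obtain ⟨Y, hY, hXY⟩ := L.exists_form_eq_one h.vec_mem hX₁
  obtain ⟨x', hx', hvx'⟩ := L.exists_form_eq_one (h.homogeneous.map_odd h.vec_mem) hv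
  have hpair : L.IsOddHyperbolicPair X₁ Y := ⟨h.vec_mem, hY, hXY⟩
  have hcomm : L.bracket x (L.bracket x' Y) = L.bracket x' (L.bracket x Y) := by
    rw [L.jacobi 0 0 1 x hx x' hx' Y hY, h.bracket_even_even hx hx', superSign_zero_left]
    simp
  rw [h.bracket_even_bracket_even hx hx' hpair, h.bracket_even_bracket_even hx' hx hpair, hvx,
    hvx', L.form_comm_of_odd (h.homogeneous.map_even hx') (C x)] at hcomm
  set c := -(L.form (C x) Y + 2 * L.form (C x) (C x')) with hc
  have hCx : C x = c • X₁ := by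
    rw [hc]
    linear_combination (norm := module) hcomm
  have hY' : L.form (C x) Y = c := by simp [hCx, hXY]
  have hx'' : L.form (C x) (C x') = c := by simp [hCx, h.form_vec_map, hvx']
  have hc₀ : c = 0 := by
    rw [hY', hx''] at hc
    linear_combination hc / 4
  rw [hCx, hc₀, zero_smul]

theorem map_vec_eq_zero
    (hC : ∀ (α : Module.Dual ℂ V) (u : V), ¬ ∀ x ∈ L.part 0, C x = α x • u) : C X₁ = 0 := by
  by_contra hv
  obtain ⟨x', hx', hvx'⟩ := L.exists_form_eq_one (h.homogeneous.map_odd h.vec_mem) hv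
  refine hC (L.form (C X₁)) (C x') fun x hx => ?_
  have hker := h.map_eq_zero_of_form_map_vec_eq_zero hv
    (sub_mem hx ((L.part 0).smul_mem (L.form (C X₁) x) hx')) (by simp [hvx'])
  rwa [map_sub, map_smul, sub_eq_zero] at hker

theorem map_map_even_eq_zero (hv : C X₁ = 0) (hY : L.IsOddHyperbolicPair X₁ Y₁) {x : V}
    (hx : x ∈ L.part 0) : C (C x) = 0 := by
  have hxY : L.bracket (L.bracket x Y₁) Y₁ = 0 := by
    have hx₀ := bracket_even_bracket_self hx hY.right_mem
    rw [h.bracket_even_even hx (L.bracket_mem 1 1 _ hY.right_mem _ hY.right_mem)] at hx₀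
    exact (smul_eq_zero.1 hx₀.symm).resolve_left two_ne_zero
  have hCx := h.homogeneous.map_even hx
  simpa [h.bracket_even_left hx, hY.form_eq_one, h.bracket_odd_odd hCx hY.right_mem,
    h.bracket_odd_odd h.vec_mem hY.right_mem, h.form_vec_map, h.form_vec_vec, hv] using hxY

theorem map_map_eq_zero_of_pair (hY : L.IsOddHyperbolicPair X₁ Y₁) : C (C Y₁) = 0 := by
  have hCY := h.homogeneous.map_odd hY.right_mem
  have hYY : L.bracket (C Y₁) Y₁ = 0 := by
    have hcube := bracket_bracket_self_of_odd hY.right_mem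
    rw [h.bracket_self hY, map_smul, LinearMap.smul_apply] at hcube
    exact (smul_eq_zero.1 hcube).resolve_left two_ne_zero
  rw [h.bracket_even_left hCY, hY.form_eq_one] at hYY
  set c := L.form (C (C Y₁)) Y₁ with hc
  have hCCY : C (C Y₁) = -c • X₁ := by linear_combination (norm := module) -hYY
  have hc₀ : c = 0 := by
    rw [hCCY, map_smul, LinearMap.smul_apply, hY.form_eq_one, smul_eq_mul] at hc
    linear_combination hc / 2
  rw [hCCY, hc₀, neg_zero, zero_smul]

theorem map_map_odd_eq_zero (hY : L.IsOddHyperbolicPair X₁ Y₁) {x : V} (hx : x ∈ L.part 1) :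
    C (C x) = 0 := by
  set c := 1 - L.form X₁ x with hc
  have hpair : L.IsOddHyperbolicPair X₁ (x + c • Y₁) :=
    ⟨h.vec_mem, add_mem hx (Submodule.smul_mem _ _ hY.right_mem), by simp [hY.form_eq_one, hc]⟩
  simpa [h.map_map_eq_zero_of_pair hY] using h.map_map_eq_zero_of_pair hpair

theorem isNilpotentWedgeBracket (hX₁ : X₁ ≠ 0)
    (hC : ∀ (α : Module.Dual ℂ V) (u : V), ¬ ∀ x ∈ L.part 0, C x = α x • u) :
    L.IsNilpotentWedgeBracket C X₁ where
  toIsWedgeBracket := h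
  map_vec := h.map_vec_eq_zero hC
  map_map x := by
    obtain ⟨Y, hY, hXY⟩ := L.exists_form_eq_one h.vec_mem hX₁
    have hpair : L.IsOddHyperbolicPair X₁ Y := ⟨h.vec_mem, hY, hXY⟩
    obtain ⟨a, ha, b, hb, rfl⟩ := L.exists_even_add_odd x
    rw [map_add, map_add, h.map_map_even_eq_zero (h.map_vec_eq_zero hC) hpair ha,
      h.map_map_odd_eq_zero hpair hb, add_zero]

theorem derived_le : L.derived ≤ LinearMap.range C ⊔ Submodule.span ℂ {X₁} := by
  refine Submodule.span_le.2 ?_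
  rintro _ ⟨x, y, rfl⟩
  rw [h.bracket_eq, ← map_smul, ← map_smul, ← map_sub]
  exact sub_mem (Submodule.mem_sup_left (LinearMap.mem_range_self C _))
    (Submodule.mem_sup_right (Submodule.smul_mem _ _ (Submodule.mem_span_singleton_self X₁)))

theorem derived_ne_bot (hX₁ : X₁ ≠ 0) (hC : C ≠ 0) : L.derived ≠ ⊥ := by
  intro hL
  have hbracket (x y : V) : L.bracket x y = 0 := by
    have hxy : L.bracket x y ∈ L.derived := Submodule.subset_span ⟨x, y, rfl⟩
    rwa [hL, Submodule.mem_bot] at hxy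
  obtain ⟨Y, hY, hXY⟩ := L.exists_form_eq_one h.vec_mem hX₁
  have hCY : C Y = 0 := by
    have hYY := h.bracket_self ⟨h.vec_mem, hY, hXY⟩
    rw [hbracket] at hYY
    exact (smul_eq_zero.1 hYY.symm).resolve_left two_ne_zero
  refine hC (LinearMap.ext fun x => ?_)
  simpa [hbracket, hXY, L.parity_odd hY, hCY] using (h.bracket_eq Y x).symm

theorem bracket_pair_left (hY : L.IsOddHyperbolicPair X₁ Y₁) {x : V} (hx : L.form X₁ x = 0) :
    L.bracket Y₁ x = C x - L.form x (C Y₁) • X₁ := by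
  rw [h.bracket_eq, hY.form_eq_one, hx,
    L.form_comm_of_even (h.homogeneous.map_odd hY.right_mem)]
  module

theorem bracket_eq_neg_form_smul {x y : V} (hx : L.form X₁ x = 0) (hy : L.form X₁ y = 0) :
    L.bracket x y = -(L.form (C x) y • X₁) := by
  rw [h.bracket_eq, hx, hy]
  module

theorem form_vec_of_mem_sup {x : V} (hx : x ∈ L.pairOrthogonal X₁ Y₁ ⊔ Submodule.span ℂ {X₁}) :
    L.form X₁ x = 0 := by
  obtain ⟨y, hy, _, hz, rfl⟩ := Submodule.mem_sup.1 hx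
  obtain ⟨c, rfl⟩ := Submodule.mem_span_singleton.1 hz
  simp [(QuadraticSuperspace.mem_pairOrthogonal.1 hy).1, h.form_vec_vec]

end IsWedgeBracket

namespace IsNilpotentWedgeBracket

variable (h : L.IsNilpotentWedgeBracket C X₁)
include h

theorem form_map_map (x y : V) : L.form (C x) (C y) = 0 := by
  rw [h.form_map_antisymm, h.map_map, map_zero, LinearMap.zero_apply, neg_zero]

theorem form_vec_map_eq_zero (x : V) : L.form X₁ (C x) = 0 := by
  rw [h.form_vec_map, h.map_vec, map_zero, LinearMap.zero_apply]

theorem map_parity_map (x : V) : C (L.parity (C x)) = 0 := by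
  obtain ⟨a, ha, b, hb, rfl⟩ := L.exists_even_add_odd x
  simp [L.parity_odd (h.homogeneous.map_even ha), L.parity_even (h.homogeneous.map_odd hb),
    h.map_map]

theorem range_le_center : LinearMap.range C ≤ L.center := by
  rintro _ ⟨x, rfl⟩
  refine LinearMap.mem_ker.2 (LinearMap.ext fun y => ?_)
  simp [h.bracket_eq, h.map_map, h.form_vec_map_eq_zero, h.map_parity_map]

theorem bracket_vec_left (x : V) : L.bracket X₁ x = 0 := by
  simp [h.bracket_eq, h.map_vec, h.form_vec_vec, L.parity_odd h.vec_mem]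

theorem bracket_vec_right (x : V) : L.bracket x X₁ = 0 := by
  rw [bracket_odd_right h.vec_mem, h.bracket_vec_left, neg_zero]

theorem bracket_map_right (x y : V) : L.bracket x (C y) = 0 := by
  simp [h.bracket_eq, h.map_map, h.form_vec_map_eq_zero, h.form_map_map]

theorem range_sup_span_le_center : LinearMap.range C ⊔ Submodule.span ℂ {X₁} ≤ L.center :=
  sup_le h.range_le_center ((Submodule.span_singleton_le_iff_mem _ _).2
    (LinearMap.mem_ker.2 (LinearMap.ext h.bracket_vec_left)))

theorem isTwoStepNilpotent (hX₁ : X₁ ≠ 0) (hC : C ≠ 0) : L.IsTwoStepNilpotent := by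
  refine ⟨h.derived_ne_bot hX₁ hC, fun x y hy => ?_⟩
  obtain ⟨_, ⟨z, rfl⟩, w, hw, rfl⟩ := Submodule.mem_sup.1 (h.derived_le hy)
  obtain ⟨c, rfl⟩ := Submodule.mem_span_singleton.1 hw
  rw [map_add, map_smul, h.bracket_map_right, h.bracket_vec_right, smul_zero, add_zero]

theorem derived_eq_and_eq_center [FiniteDimensional ℂ V] (hL : L.IsReduced) :
    L.derived = LinearMap.range C ⊔ Submodule.span ℂ {X₁} ∧
      LinearMap.range C ⊔ Submodule.span ℂ {X₁} = L.center :=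
  have hcenter : L.center ≤ L.derived := center_le_derived_of_isotropic hL.2
  ⟨h.derived_le.antisymm (h.range_sup_span_le_center.trans hcenter),
    h.range_sup_span_le_center.antisymm (hcenter.trans h.derived_le)⟩

section DoubleExtension

variable (hY : L.IsOddHyperbolicPair X₁ Y₁)
include hY

theorem map_add_smul_mem_pairOrthogonal (x : V) :
    C x + L.form x (C Y₁) • X₁ ∈ L.pairOrthogonal X₁ Y₁ := by
  have hYx : L.form Y₁ (C x) = L.form x (C Y₁) := by
    rw [L.form_comm_of_odd hY.right_mem, ← h.form_map_antisymm,
      L.form_comm_of_even (h.homogeneous.map_odd hY.right_mem)]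
  rw [QuadraticSuperspace.mem_pairOrthogonal]
  simp [h.form_vec_map_eq_zero, h.form_vec_vec, hYx, hY.form_swap]

/-- The data `(C̄, X₀')` of the generalized double extension: on `𝔮 = (ℂ X₁ ⊕ ℂ Y₁)^⊥`, the map
`C̄ x = C x + B(x, C Y₁) X₁` and the vector `X₀' = 2 C Y₁`. -/
noncomputable def datum : ExtensionDatum (L.pairOrthogonal X₁ Y₁) where
  toQuadraticSuperspace := hY.orthogonalSuperspace
  map := LinearMap.codRestrict _
    ((C + (L.form.flip (C Y₁)).smulRight X₁) ∘ₗ (L.pairOrthogonal X₁ Y₁).subtype)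
    fun x => h.map_add_smul_mem_pairOrthogonal hY x
  map_odd := by
    rintro i x (hx : (x : V) ∈ L.part i)
    change C x + L.form x (C Y₁) • X₁ ∈ L.part (i + 1)
    refine add_mem (h.homogeneous i x hx) ?_
    rcases ExtensionDatum.parity_cases i with rfl | rfl
    · exact Submodule.smul_mem _ _ h.vec_mem
    · simp [L.form_odd_even hx (h.homogeneous.map_odd hY.right_mem)]
  map_skew := by
    refine QuadraticSuperspace.isSkewSupersymmetric_one_iff.2 fun x y => ?_
    change L.form (C x + L.form x (C Y₁) • X₁) y = -L.form (C y + L.form y (C Y₁) • X₁) x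
    simp [(QuadraticSuperspace.mem_pairOrthogonal.1 x.2).1,
      (QuadraticSuperspace.mem_pairOrthogonal.1 y.2).1, h.form_map_antisymm x y]
  map_sq x := by
    apply Subtype.ext
    change C (C x + L.form x (C Y₁) • X₁) +
      L.form (C x + L.form x (C Y₁) • X₁) (C Y₁) • X₁ = 0
    simp [h.map_map, h.map_vec, h.form_map_map, h.form_vec_map_eq_zero]
  vec := ⟨(2 : ℂ) • C Y₁, Submodule.smul_mem _ _ (QuadraticSuperspace.mem_pairOrthogonal.2
    ⟨h.form_vec_map_eq_zero Y₁,
      L.form_odd_even hY.right_mem (h.homogeneous.map_odd hY.right_mem)⟩)⟩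
  vec_even := Submodule.smul_mem _ _ (h.homogeneous.map_odd hY.right_mem)
  vec_isotropic := by
    change L.form ((2 : ℂ) • C Y₁) ((2 : ℂ) • C Y₁) = 0
    simp [h.form_map_map]
  map_vec := by
    apply Subtype.ext
    change C ((2 : ℂ) • C Y₁) + L.form ((2 : ℂ) • C Y₁) (C Y₁) • X₁ = 0
    simp [h.map_map, h.form_map_map]

theorem coe_datum_vec : ((h.datum hY).vec : V) = (2 : ℂ) • C Y₁ := rfl

theorem map_eq_datum_map_sub (x : L.pairOrthogonal X₁ Y₁) :
    C x = (h.datum hY).map x - L.form x (C Y₁) • X₁ :=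
  eq_sub_of_add_eq rfl

theorem coe_datum_theta (x : L.pairOrthogonal X₁ Y₁) :
    ((h.datum hY).theta x : V) = L.parity x := by
  obtain ⟨a, ha, b, hb, rfl⟩ := (h.datum hY).exists_add x
  rw [map_add, (h.datum hY).theta_even ha, (h.datum hY).theta_odd hb, Submodule.coe_add,
    Submodule.coe_add, Submodule.coe_neg, map_add, L.parity_even (x := (a : V)) ha,
    L.parity_odd (x := (b : V)) hb]

theorem bracket_left_eq_datum (x : L.pairOrthogonal X₁ Y₁) :
    L.bracket Y₁ x = (h.datum hY).map x - L.form x (h.datum hY).vec • X₁ := by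
  rw [h.bracket_pair_left hY (QuadraticSuperspace.mem_pairOrthogonal.1 x.2).1,
    h.map_eq_datum_map_sub hY, coe_datum_vec, map_smul]
  module

theorem bracket_right_eq_datum (x : L.pairOrthogonal X₁ Y₁) :
    L.bracket x Y₁ =
      -((h.datum hY).map ((h.datum hY).theta x) : V) + L.form x (h.datum hY).vec • X₁ := by
  have hform : L.form (L.parity x) (h.datum hY).vec = L.form x (h.datum hY).vec := by
    rw [← h.coe_datum_theta hY]
    exact (h.datum hY).form_theta_vec x
  rw [bracket_odd_right hY.right_mem, ← h.coe_datum_theta hY, h.bracket_left_eq_datum hY,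
    h.coe_datum_theta hY, hform]
  abel

theorem bracket_eq_datum (x y : L.pairOrthogonal X₁ Y₁) :
    L.bracket x y = -(L.form ((h.datum hY).map x) y • X₁) := by
  have hx := (QuadraticSuperspace.mem_pairOrthogonal.1 x.2).1
  have hy := (QuadraticSuperspace.mem_pairOrthogonal.1 y.2).1
  rw [h.bracket_eq_neg_form_smul hx hy, h.map_eq_datum_map_sub hY]
  simp [hy]

theorem decomposition_bracket (v w : V) :
    hY.decomposition (L.bracket v w) =
      (h.datum hY).extension.bracket (hY.decomposition v) (hY.decomposition w) := by
  obtain ⟨x, a, b, rfl⟩ := hY.exists_eq_add_smul_add_smul v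
  obtain ⟨y, c, d, rfl⟩ := hY.exists_eq_add_smul_add_smul w
  rw [hY.decomposition_add, hY.decomposition_add, ExtensionDatum.extension_bracket_apply,
    ← hY.decomposition_add]
  congr 1
  change _ = _ + (-L.form ((h.datum hY).map x) y - b * L.form y (h.datum hY).vec
    + d * L.form x (h.datum hY).vec) • X₁ + _
  simp only [map_add, map_smul, LinearMap.add_apply, LinearMap.smul_apply, h.bracket_vec_left,
    h.bracket_vec_right, h.bracket_eq_datum hY, h.bracket_left_eq_datum hY,
    h.bracket_right_eq_datum hY, h.bracket_self hY, ← h.coe_datum_vec hY, Submodule.coe_add,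
    Submodule.coe_sub, Submodule.coe_smul]
  module

theorem isIsometricIso_decomposition :
    L.IsIsometricIso (h.datum hY).extension hY.decomposition where
  map_part i x hx := by
    refine ⟨hY.projection_mem hx, ?_⟩
    rcases ExtensionDatum.parity_cases i with rfl | rfl
    · simp [hY.decomposition_apply, L.form_odd_even hY.left_mem hx,
        L.form_odd_even hY.right_mem hx]
    · simp
  map_bracket := h.decomposition_bracket hY
  map_form v w := by
    obtain ⟨x, a, b, rfl⟩ := hY.exists_eq_add_smul_add_smul v
    obtain ⟨y, c, d, rfl⟩ := hY.exists_eq_add_smul_add_smul w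
    rw [hY.decomposition_add, hY.decomposition_add, ExtensionDatum.extension_form_apply,
      hY.form_add_smul_add_smul]
    rfl

theorem isGeneralizedDoubleExtension [FiniteDimensional ℂ V] : L.IsGeneralizedDoubleExtension :=
  ⟨_, _, _, inferInstance, h.datum hY, hY.decomposition, h.isIsometricIso_decomposition hY⟩

end DoubleExtension

end IsNilpotentWedgeBracket

section QuasiSingular

variable [FiniteDimensional ℂ V] {J : Module.Dual ℂ (L.part 0) ⊗[ℂ] Module.Dual ℂ (L.part 1)}
  {p : Module.Dual ℂ (L.part 1)}

theorem form_mapOf (x y : V) : L.form (L.mapOf J x) y = L.tensorForm J x y :=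
  L.form_phi_symm (L.tensorForm J x) y

theorem form_vectorOf (x : V) : L.form (L.vectorOf p) x = L.extendOdd p x :=
  L.form_phi_symm (L.extendOdd p) x

theorem vectorOf_ne_zero (hp : p ≠ 0) : L.vectorOf p ≠ 0 := by
  intro h₀
  refine hp (LinearMap.ext fun x => ?_)
  rw [← L.extendOdd_apply, ← form_vectorOf, h₀]
  simp

theorem eq_tmul_of_mapOf_eq_smul {α : Module.Dual ℂ V} {u : V}
    (hJ : ∀ x ∈ L.part 0, L.mapOf J x = α x • u) :
    J = (α ∘ₗ (L.part 0).subtype) ⊗ₜ (L.form u ∘ₗ (L.part 1).subtype) := by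
  refine QuadraticSuperspace.ext_tensorForm fun x y => ?_
  rw [← form_mapOf, hJ x x.2, L.tensorForm_tmul, L.extendEven_apply, L.extendOdd_apply,
    L.extendOdd_even _ x.2]
  simp

theorem isWedgeBracket_of_associatedInvariant_eq
    (hI : ∀ x y z, L.associatedInvariant x y z =
      L.superWedge (L.tensorForm J) 1 (L.extendOdd p) x y z) :
    L.IsWedgeBracket (L.mapOf J) (L.vectorOf p) where
  homogeneous := QuadraticSuperspace.isHomogeneous_one_of_form
    (fun x hx y hy => by rw [form_mapOf, L.tensorForm_even_even J hx hy])
    (fun x hx y hy => by rw [form_mapOf, L.tensorForm_odd_odd J hx hy])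
  skew := QuadraticSuperspace.isSkewSupersymmetric_one_iff.2 fun x y => by
    rw [form_mapOf, form_mapOf, L.tensorForm_antisymm]
  vec_mem := L.mem_part_of_form_eq_zero fun x hx => by rw [form_vectorOf, L.extendOdd_even p hx]
  bracket_eq x y := L.ext_form fun z => by
    have hxyz := hI x y z
    rw [associatedInvariant, L.superWedge_one_apply
      (fun _ hx _ hy => L.tensorForm_even_even J hx hy)
      (fun _ hx _ hy => L.tensorForm_odd_odd J hx hy)
      (fun _ hx => L.extendOdd_even p hx)] at hxyz
    simp only [map_sub, map_smul, LinearMap.sub_apply, LinearMap.smul_apply, smul_eq_mul,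
      form_mapOf, form_vectorOf, hxyz]
    ring

namespace IsQuasiSingularWith

variable (h : L.IsQuasiSingularWith J p)
include h

theorem mapOf_ne_smul_on_even (α : Module.Dual ℂ V) (u : V) :
    ¬ ∀ x ∈ L.part 0, L.mapOf J x = α x • u :=
  fun hJ => h.indecomposable _ _ (eq_tmul_of_mapOf_eq_smul hJ)

theorem mapOf_ne_zero : L.mapOf J ≠ 0 :=
  fun h₀ => h.mapOf_ne_smul_on_even 0 0 fun x _ => by simp [h₀]

theorem isNilpotentWedgeBracket : L.IsNilpotentWedgeBracket (L.mapOf J) (L.vectorOf p) :=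
  (isWedgeBracket_of_associatedInvariant_eq h.invariant_eq).isNilpotentWedgeBracket
    (vectorOf_ne_zero h.ne_zero) h.mapOf_ne_smul_on_even

end IsQuasiSingularWith

end QuasiSingular

end QuadraticLieSuperalgebra

end QuasiSingular

open QuasiSingular in
theorem corollary3p6p5 {V : Type*} [AddCommGroup V] [Module ℂ V] [FiniteDimensional ℂ V]
    (L : QuadraticLieSuperalgebra V)
    (J : TensorProduct ℂ (Module.Dual ℂ (L.part 0)) (Module.Dual ℂ (L.part 1)))
    (p : Module.Dual ℂ (L.part 1)) (h : L.IsQuasiSingularWith J p)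
    (C : V →ₗ[ℂ] V) (hC : C = L.mapOf J) (X₁ : V) (hX₁ : X₁ = L.vectorOf p) :
    -- `C` is odd, skew-supersymmetric, of square zero, with central image
    L.IsHomogeneous 1 C ∧ L.IsSkewSupersymmetric 1 C ∧ (∀ X, C (C X) = 0) ∧
    LinearMap.range C ≤ L.center ∧
    -- the derived ideal and the center
    L.derived ≤ LinearMap.range C ⊔ Submodule.span ℂ {X₁} ∧
    LinearMap.range C ⊔ Submodule.span ℂ {X₁} ≤ L.center ∧
    L.IsTwoStepNilpotent ∧
    (L.IsReduced →
      L.derived = LinearMap.range C ⊔ Submodule.span ℂ {X₁} ∧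
      LinearMap.range C ⊔ Submodule.span ℂ {X₁} = L.center) ∧
    -- the structure with respect to an odd vector `Y₁` with `B(X₁, Y₁) = 1`
    X₁ ∈ L.part 1 ∧ (∃ Y₁ ∈ L.part 1, L.form X₁ Y₁ = 1) ∧
    (∀ Y₁ ∈ L.part 1, L.form X₁ Y₁ = 1 → ∀ (X₀ : V) (q : Submodule ℂ V), X₀ = C Y₁ →
      q = L.form.orthogonal (Submodule.span ℂ {X₁, Y₁}) →
      -- the bracket in terms of `C`
      L.bracket Y₁ Y₁ = (2 : ℂ) • X₀ ∧
      (∀ X ∈ q ⊔ Submodule.span ℂ {X₁}, L.bracket Y₁ X = C X - L.form X X₀ • X₁) ∧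
      (∀ X ∈ q ⊔ Submodule.span ℂ {X₁}, ∀ Y ∈ q ⊔ Submodule.span ℂ {X₁},
        L.bracket X Y = -(L.form (C X) Y • X₁)) ∧
      -- `𝔮` with the induced grading and form, the `𝔮`-part of `C` and the vector `2 X₀`
      -- form a datum whose generalized double extension is `𝔤`
      ∃ D : ExtensionDatum q,
        (∀ i, D.part i = (L.part i).comap q.subtype) ∧
        (∀ X Y : q, D.form X Y = L.form X Y) ∧
        (∀ X : q, C X = (D.map X : V) - L.form X X₀ • X₁) ∧
        (D.vec : V) = (2 : ℂ) • X₀ ∧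
        L.bracket Y₁ Y₁ = D.vec ∧
        (∀ X : q, L.bracket Y₁ X = (D.map X : V) - L.form X D.vec • X₁) ∧
        (∀ X Y : q, L.bracket X Y = -(L.form (D.map X : V) Y • X₁)) ∧
        ∃ e : V ≃ₗ[ℂ] q × ℂ × ℂ,
          (∀ (X : q) (a b : ℂ), e (X + a • X₁ + b • Y₁) = (X, a, b)) ∧
          L.IsIsometricIso D.extension e) ∧
    L.IsGeneralizedDoubleExtension := by
  subst hC hX₁
  have hw := h.isNilpotentWedgeBracket
  have hX₁ := QuadraticLieSuperalgebra.vectorOf_ne_zero (L := L) h.ne_zero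
  obtain ⟨Y, hY, hXY⟩ := L.exists_form_eq_one hw.vec_mem hX₁
  refine ⟨hw.homogeneous, hw.skew, hw.map_map, hw.range_le_center, hw.derived_le,
    hw.range_sup_span_le_center, hw.isTwoStepNilpotent hX₁ h.mapOf_ne_zero,
    hw.derived_eq_and_eq_center, hw.vec_mem, ⟨Y, hY, hXY⟩, ?_,
    hw.isGeneralizedDoubleExtension ⟨hw.vec_mem, hY, hXY⟩⟩
  rintro Y₁ hY₁ hXY₁ _ _ rfl rfl
  have hpair : L.IsOddHyperbolicPair (L.vectorOf p) Y₁ := ⟨hw.vec_mem, hY₁, hXY₁⟩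
  exact ⟨hw.bracket_self hpair,
    fun X hX => hw.bracket_pair_left hpair (hw.form_vec_of_mem_sup hX),
    fun X hX Y hY =>
      hw.bracket_eq_neg_form_smul (hw.form_vec_of_mem_sup hX) (hw.form_vec_of_mem_sup hY),
    hw.datum hpair, fun _ => rfl, fun _ _ => rfl, hw.map_eq_datum_map_sub hpair,
    hw.coe_datum_vec hpair, hw.bracket_self hpair, hw.bracket_left_eq_datum hpair,
    hw.bracket_eq_datum hpair, hpair.decomposition, hpair.decomposition_add,
    hw.isIsometricIso_decomposition hpair⟩
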